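/- For a sequence $a=(a_n)_{n\ge 0}$ put $\Delta a_n=a_{n+1}-a_n$. Let $r_n=e^{-n}$ and, for $\gamma\in\mathbb R$, consider the difference equations $$\text{(1)}\quad \Delta(e^{-n}\Delta y_n)=(n+1)^{\gamma}e^{-(n+1)}y_{n+1},\qquad \text{(2)}\quad \Delta(e^{-n}\Delta z_n)=0\cdot z_{n+1},\qquad n\ge 0.$$ A fundamental system of solutions is a pair of linearly independent solutions. Call a real fundamental system $\{u_n\},\{v_n\}$ of (2) a principal system if $r_n(v_{n+1}u_n-u_{n+1}v_n)=1$ for all $n\ge 0$, $\lim_{n\to\infty}u_n/v_n=0$, and there is $n_0$ such that $u_n>0$, $v_n>0$ for $n\ge n_0$ and $$\sum_{n\ge n_0}\frac1{r_nu_nu_{n+1}}=\infty,\qquad \sum_{n\ge n_0}\frac1{r_nv_nv_{n+1}}<\infty .$$ Given a principal system, the Hartman–Wintner problem is said to be solvable if (1) has a (complex) fundamental system of solutions $\{\tilde u_n\},\{\tilde v_n\}$ such that, as $n\to\infty$, $$\frac{\tilde u_n}{u_n}\to 1,\quad \frac{\tilde v_n}{v_n}\to 1,\quad \frac{\tilde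 u_{n+1}}{\tilde u_n}=\frac{u_{n+1}}{u_n}+o\Big(\frac1{r_nu_nv_n}\Big),\quad \frac{\tilde v_{n+1}}{\tilde v_n}=\frac{v_{n+1}}{v_n}+o\Big(\frac1{r_nu_nv_n}\Big).$$ Then equation (2) has a principal system, and for every principal system of (2) the Hartman–Wintner problem 1. is not solvable for $\gamma\ge 0$ and for $\gamma\in[-1,-\tfrac12)$; 2. is solvable for $\gamma\in(-\infty,-1)$. -/

import Mathlib

open Filter Topology Asymptotics

namespace HartmanWintner

/-- The sequence `y_0, y_1, y_2, …` solves the second order linear difference equation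
`Δ(r_n Δy_n) = p_{n+1} y_{n+1}`, `n ≥ 0`, where `Δ a_n = a_{n+1} - a_n`. -/
def IsSolution {K : Type*} [Field K] (r p y : ℕ → K) : Prop :=
  ∀ n : ℕ, fwdDiff 1 (fun k => r k * fwdDiff 1 y k) n = p (n + 1) * y (n + 1)

/-- A fundamental system of solutions: two linearly independent solutions. -/
structure IsFundamentalSystem {K : Type*} [Field K] (r p y₁ y₂ : ℕ → K) : Prop where
  left : IsSolution r p y₁
  right : IsSolution r p y₂
  linearIndependent : LinearIndependent K ![y₁, y₂]

/-- `u` is a principal and `v` a non-principal solution of the real unperturbed equation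
`Δ(r_n Δz_n) = q_{n+1} z_{n+1}`, eventually positive, with Casoratian normalized to `1`. -/
structure IsPrincipalSystem (r q u v : ℕ → ℝ) : Prop where
  fundamental : IsFundamentalSystem r q u v
  casoratian : ∀ n : ℕ, r n * (v (n + 1) * u n - u (n + 1) * v n) = 1
  tendsto_ratio : Tendsto (fun n => u n / v n) atTop (𝓝 0)
  eventually_pos : ∃ n₀ : ℕ,
    (∀ n, n₀ ≤ n → 0 < u n ∧ 0 < v n) ∧
    Tendsto (fun N => ∑ n ∈ Finset.Ico n₀ N, 1 / (r n * u n * u (n + 1))) atTop atTop ∧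
    Summable (fun k => 1 / (r (n₀ + k) * v (n₀ + k) * v (n₀ + k + 1)))

/-- Solvability of the Hartman–Wintner problem, relative to the system `u, v` of the unperturbed
equation: the perturbed equation `Δ(r_n Δy_n) = (q_{n+1} + σ_{n+1}) y_{n+1}` has a fundamental
system of (complex) solutions `U, V` with the prescribed asymptotics. -/
def Solvable (r q : ℕ → ℝ) (σ : ℕ → ℂ) (u v : ℕ → ℝ) : Prop :=
  ∃ U V : ℕ → ℂ,
    IsFundamentalSystem (fun n => (r n : ℂ)) (fun n => (q n : ℂ) + σ n) U V ∧
    Tendsto (fun n => U n / (u n : ℂ)) atTop (𝓝 1) ∧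
    Tendsto (fun n => V n / (v n : ℂ)) atTop (𝓝 1) ∧
    (fun n => U (n + 1) / U n - (u (n + 1) : ℂ) / (u n : ℂ))
      =o[atTop] (fun n => 1 / (r n * u n * v n)) ∧
    (fun n => V (n + 1) / V n - (v (n + 1) : ℂ) / (v n : ℂ))
      =o[atTop] (fun n => 1 / (r n * u n * v n))

/-- `r_n = e^{-n}`. -/
noncomputable def expCoeff (n : ℕ) : ℝ := Real.exp (-(n : ℝ))

/-- `σ_n = n^γ e^{-n}`; only the values with `n ≥ 1` enter the equation. -/
noncomputable def powExpPerturbation (γ : ℝ) (n : ℕ) : ℂ :=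
  (((n : ℝ) ^ γ * Real.exp (-(n : ℝ)) : ℝ) : ℂ)

end HartmanWintner

namespace HartmanWintner

/-! ### Three-term recurrence form of the equations. -/

section Recurrence

variable {K : Type*} [Field K]

/-! Dividing by `r (n + 1)` turns (1) into `y (n + 2) = (1 + e + P) * y (n + 1) - e * y n` with `P =
(n + 1) ^ γ`. For `P = 0` the solutions are `a + b * e ^ n`, so in a principal system `u` is a
positive constant, `v` grows like `e ^ n`, and `1 / (r n * u n * v n)` has a positive limit: the
error terms are just `o(1)`. Solvability is then decided by whether `∑ n ^ γ` converges.

If a solution tends to `1`, then `y (n + 1) - e * y n` converges while its increments are `P * y (n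
+ 1)`, so `∑ P < ∞` (`summable_of_recurrence_of_tendsto`). Conversely, summability gives a solution
`e ^ n * s n` with `s` convergent (`exists_scaled_solution`), and reduction of order gives one with
a positive limit (`exists_convergent_solution`). -/

theorem isSolution_iff_recurrence {r : ℕ → K} {e : K} (hr : ∀ n, r n ≠ 0)
    (hre : ∀ n, r n = e * r (n + 1)) (P y : ℕ → K) :
    IsSolution r (fun n => P n * r n) y ↔
      ∀ n, y (n + 2) = (1 + e + P (n + 1)) * y (n + 1) - e * y n := by
  refine forall_congr' fun n => ?_
  have h1 : fwdDiff 1 (fun k => r k * fwdDiff 1 y k) n =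
      r (n + 1) * (y (n + 2) - y (n + 1)) - r n * (y (n + 1) - y n) := rfl
  rw [h1, hre n]
  constructor
  · intro h
    apply mul_left_cancel₀ (hr (n + 1))
    linear_combination h
  · intro h
    linear_combination r (n + 1) * h

end Recurrence

theorem expCoeff_pos (n : ℕ) : 0 < expCoeff n := Real.exp_pos _

theorem expCoeff_succ (n : ℕ) : expCoeff n = Real.exp 1 * expCoeff (n + 1) := by
  rw [expCoeff, expCoeff, ← Real.exp_add]
  push_cast
  ring_nf

theorem expCoeff_eq_inv_pow (n : ℕ) : expCoeff n = (Real.exp 1 ^ n)⁻¹ := by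
  rw [expCoeff, Real.exp_neg, ← Real.exp_nat_mul, mul_one]

theorem one_lt_exp_one : 1 < Real.exp 1 := Real.one_lt_exp_iff.mpr one_pos

theorem tendsto_expCoeff : Tendsto expCoeff atTop (𝓝 0) := by
  have h : expCoeff = fun n => (Real.exp 1 ^ n)⁻¹ := funext expCoeff_eq_inv_pow
  rw [h]
  exact (tendsto_pow_atTop_atTop_of_one_lt one_lt_exp_one).inv_tendsto_atTop

theorem isSolution_expCoeff_iff (P y : ℕ → ℝ) :
    IsSolution expCoeff (fun n => P n * expCoeff n) y ↔
      ∀ n, y (n + 2) = (1 + Real.exp 1 + P (n + 1)) * y (n + 1) - Real.exp 1 * y n :=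
  isSolution_iff_recurrence (fun n => (expCoeff_pos n).ne') expCoeff_succ P y

theorem isSolution_expCoeff_zero_iff (y : ℕ → ℝ) :
    IsSolution expCoeff (fun _ => 0) y ↔
      ∀ n, y (n + 2) = (1 + Real.exp 1) * y (n + 1) - Real.exp 1 * y n := by
  simpa using isSolution_expCoeff_iff (fun _ => 0) y

theorem isSolution_powExpPerturbation_iff (γ : ℝ) (y : ℕ → ℂ) :
    IsSolution (fun n => (expCoeff n : ℂ))
        (fun n => (((fun _ => 0 : ℕ → ℝ) n : ℝ) : ℂ) + powExpPerturbation γ n) y ↔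
      ∀ n, y (n + 2) = (1 + (Real.exp 1 : ℂ) + (((n + 1 : ℕ) : ℝ) ^ γ : ℝ)) * y (n + 1)
        - (Real.exp 1 : ℂ) * y n := by
  have h := isSolution_iff_recurrence (r := fun n => (expCoeff n : ℂ)) (e := (Real.exp 1 : ℂ))
    (fun n => by exact_mod_cast (expCoeff_pos n).ne')
    (fun n => by exact_mod_cast congrArg (fun x : ℝ => (x : ℂ)) (expCoeff_succ n))
    (fun n => (((n : ℝ) ^ γ : ℝ) : ℂ)) y
  rw [← h]
  have hσ : (fun n => (((fun _ => 0 : ℕ → ℝ) n : ℝ) : ℂ) + powExpPerturbation γ n) =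
      fun n : ℕ => (((n : ℝ) ^ γ : ℝ) : ℂ) * (expCoeff n : ℂ) := by
    funext n
    simp only [powExpPerturbation, expCoeff, Complex.ofReal_mul, Complex.ofReal_zero, zero_add]
  rw [hσ]

/-! ### Principal systems of the unperturbed equation. -/

section Unperturbed

/-- Solutions of the unperturbed equation are combinations of `1` and `e ^ n`. -/
theorem exists_eq_add_mul_exp_pow {y : ℕ → ℝ} (hy : IsSolution expCoeff (fun _ => 0) y) :
    ∃ a b : ℝ, ∀ n : ℕ, y n = a + b * Real.exp 1 ^ n := by
  rw [isSolution_expCoeff_zero_iff] at hy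
  have he : Real.exp 1 - 1 ≠ 0 := (sub_pos.mpr one_lt_exp_one).ne'
  refine ⟨y 0 - (y 1 - y 0) / (Real.exp 1 - 1), (y 1 - y 0) / (Real.exp 1 - 1), fun n => ?_⟩
  induction n using Nat.twoStepInduction with
  | zero => simp
  | one => field_simp; ring
  | more n h0 h1 => rw [hy, h0, h1]; ring

theorem tendsto_expCoeff_mul {y : ℕ → ℝ} {a b : ℝ} (hy : ∀ n : ℕ, y n = a + b * Real.exp 1 ^ n) :
    Tendsto (fun n => expCoeff n * y n) atTop (𝓝 b) := by
  have h : (fun n : ℕ => expCoeff n * y n) = fun n => expCoeff n * a + b := by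
    funext n
    rw [hy, expCoeff_eq_inv_pow]
    have := Real.exp_pos 1
    field_simp
  rw [h]
  simpa using (tendsto_expCoeff.mul_const a).add_const b

theorem IsPrincipalSystem.exists_const {u v : ℕ → ℝ}
    (h : IsPrincipalSystem expCoeff (fun _ => 0) u v) :
    ∃ a b : ℝ, 0 < a ∧ 0 < b ∧ (∀ n, u n = a) ∧
      Tendsto (fun n => expCoeff n * v n) atTop (𝓝 b) := by
  obtain ⟨a, c, hu⟩ := exists_eq_add_mul_exp_pow h.fundamental.left
  obtain ⟨d, b, hv⟩ := exists_eq_add_mul_exp_pow h.fundamental.right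
  obtain ⟨n₀, hpos, -⟩ := h.eventually_pos
  have hc : c = 0 := by
    -- `r * u` tends to `c`, but it also equals `(u / v) * (r * v)`, which tends to `0 * b`.
    have h1 := h.tendsto_ratio.mul (tendsto_expCoeff_mul hv)
    rw [zero_mul] at h1
    refine tendsto_nhds_unique (tendsto_expCoeff_mul hu) (h1.congr' ?_)
    filter_upwards [eventually_ge_atTop n₀] with n hn
    have := (hpos n hn).2
    field_simp
  subst hc
  have hua : ∀ n, u n = a := fun n => by rw [hu]; ring
  have ha : 0 < a := by
    rw [← hua n₀]
    exact (hpos n₀ le_rfl).1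
  -- The Casoratian at `n = 0` forces `b > 0` once `a > 0`.
  have hb : a * b * (Real.exp 1 - 1) = 1 := by
    have h0 := h.casoratian 0
    rw [hua, hua, hv, hv, expCoeff_eq_inv_pow] at h0
    simp only [pow_zero, inv_one, zero_add, pow_one] at h0
    linarith
  refine ⟨a, b, ha, ?_, hua, tendsto_expCoeff_mul hv⟩
  have he : 0 < Real.exp 1 - 1 := sub_pos.mpr one_lt_exp_one
  by_contra hb'
  nlinarith [mul_nonneg (mul_nonneg ha.le (neg_nonneg.mpr (not_lt.mp hb'))) he.le]

theorem isPrincipalSystem_one_exp :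
    IsPrincipalSystem expCoeff (fun _ => 0) (fun _ => 1)
      (fun n => Real.exp 1 ^ n / (Real.exp 1 - 1)) := by
  have he : 0 < Real.exp 1 - 1 := sub_pos.mpr one_lt_exp_one
  have he0 := Real.exp_pos 1
  refine ⟨⟨?_, ?_, ?_⟩, ?_, ?_, 0, ?_, ?_, ?_⟩
  · rw [isSolution_expCoeff_zero_iff]
    intro n
    ring
  · rw [isSolution_expCoeff_zero_iff]
    intro n
    ring
  · rw [LinearIndependent.pair_iff]
    intro s t hst
    have h0 := congrFun hst 0
    have h1 := congrFun hst 1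
    simp only [Pi.add_apply, Pi.smul_apply, smul_eq_mul, Pi.zero_apply, pow_zero, pow_one,
      mul_one] at h0 h1
    have ht : t = 0 := by
      field_simp at h0 h1
      have : t * (Real.exp 1 - 1) = 0 := by linarith
      exact (mul_eq_zero.mp this).resolve_right he.ne'
    subst ht
    exact ⟨by simpa using h0, rfl⟩
  · intro n
    rw [expCoeff_eq_inv_pow, pow_succ]
    field_simp
  · have h : (fun n : ℕ => (1 : ℝ) / (Real.exp 1 ^ n / (Real.exp 1 - 1))) =
        fun n => (Real.exp 1 - 1) * expCoeff n := by
      funext n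
      rw [expCoeff_eq_inv_pow]
      field_simp
    rw [h]
    simpa using tendsto_expCoeff.const_mul (Real.exp 1 - 1)
  · intro n _
    exact ⟨one_pos, by positivity⟩
  · refine tendsto_atTop_mono (fun N => ?_) tendsto_natCast_atTop_atTop
    calc (N : ℝ) = ∑ _n ∈ Finset.range N, (1 : ℝ) := by simp
      _ ≤ _ := by
        rw [← Finset.range_eq_Ico]
        refine Finset.sum_le_sum fun n _ => ?_
        rw [expCoeff_eq_inv_pow, mul_one, mul_one, one_div, inv_inv]
        exact one_le_pow₀ one_lt_exp_one.le
  · have h : (fun k : ℕ => 1 / (expCoeff (0 + k) * (Real.exp 1 ^ (0 + k) / (Real.exp 1 - 1)) *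
        (Real.exp 1 ^ (0 + k + 1) / (Real.exp 1 - 1)))) =
        fun k => ((Real.exp 1 - 1) ^ 2 / Real.exp 1) * (Real.exp 1)⁻¹ ^ k := by
      funext k
      rw [zero_add, expCoeff_eq_inv_pow, inv_pow, pow_succ]
      field_simp
    rw [h]
    exact (summable_geometric_of_lt_one (by positivity)
      (inv_lt_one_of_one_lt₀ one_lt_exp_one)).mul_left _

end Unperturbed

/-! ### Divergent perturbation sums exclude a solution asymptotic to `u`. -/

section Nonexistence

/-- If `y` converges to a nonzero limit, the sum of the nonnegative coefficients `P` is finite. -/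
theorem summable_of_recurrence_of_tendsto {P : ℕ → ℝ} (hP : ∀ n, 0 ≤ P n) {e : ℂ} {y : ℕ → ℂ}
    (hy : ∀ n, y (n + 2) = (1 + e + (P n : ℂ)) * y (n + 1) - e * y n)
    (hlim : Tendsto y atTop (𝓝 1)) : Summable P := by
  have hre : Tendsto (fun n => (y (n + 1)).re) atTop (𝓝 1) := by
    have := (Complex.continuous_re.tendsto 1).comp (hlim.comp (tendsto_add_atTop_nat 1))
    simpa [Function.comp_def] using this
  obtain ⟨N, hN⟩ := eventually_atTop.mp (hre.eventually (lt_mem_nhds (by norm_num : (1 / 2 : ℝ) < 1)))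
  have hT : Tendsto (fun n => (y (n + 1) - e * y n).re) atTop (𝓝 (1 - e * 1).re) :=
    (Complex.continuous_re.tendsto _).comp
      ((hlim.comp (tendsto_add_atTop_nat 1)).sub (hlim.const_mul e))
  obtain ⟨B, hB⟩ := hT.bddAbove_range
  -- The bounded quantity `(y (n + 1) - e * y n).re` eventually increases by at least `P n / 2` per
  -- step.
  have hstep : ∀ n, (y (n + 2) - e * y (n + 1)).re - (y (n + 1) - e * y n).re =
      P n * (y (n + 1)).re := by
    intro n
    rw [← Complex.sub_re, ← Complex.re_ofReal_mul, hy n]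
    congr 1
    ring
  have hsum : ∀ k, ∑ i ∈ Finset.range k, P (i + N) / 2 ≤
      (y (k + N + 1) - e * y (k + N)).re - (y (N + 1) - e * y N).re := by
    intro k
    induction k with
    | zero => simp
    | succ k ih =>
      have h1 := hstep (k + N)
      have h2 := mul_le_mul_of_nonneg_left (hN (k + N) (by omega)).le (hP (k + N))
      rw [Finset.sum_range_succ, show k + 1 + N + 1 = k + N + 2 by omega,
        show k + 1 + N = k + N + 1 by omega]
      linarith
  have hs : Summable fun i => P (i + N) / 2 :=
    summable_of_sum_range_le (fun i => by have := hP (i + N); positivity) fun k =>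
      (hsum k).trans (sub_le_sub_right (hB ⟨k + N, rfl⟩) _)
  rw [← summable_nat_add_iff N]
  simpa using hs.mul_right 2

theorem not_solvable_of_neg_one_le {u v : ℕ → ℝ}
    (h : IsPrincipalSystem expCoeff (fun _ => 0) u v) {γ : ℝ} (hγ : -1 ≤ γ) :
    ¬ Solvable expCoeff (fun _ => 0) (powExpPerturbation γ) u v := by
  rintro ⟨U, V, hF, hU, -⟩
  obtain ⟨a, b, ha, -, hu, -⟩ := h.exists_const
  have hrec := (isSolution_powExpPerturbation_iff γ U).mp hF.left
  have hs : Summable fun n : ℕ => ((n + 1 : ℕ) : ℝ) ^ γ := by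
    refine summable_of_recurrence_of_tendsto (e := (Real.exp 1 : ℂ))
      (fun n => by positivity) (fun n => ?_) hU
    rw [hu, hu, hu, hrec]
    ring
  rw [summable_nat_add_iff (f := fun n : ℕ => (n : ℝ) ^ γ) 1, Real.summable_nat_rpow] at hs
  linarith

end Nonexistence

/-! ### Construction of both solutions for summable perturbations. -/

section Existence

/-- Discrete Grönwall bound, from `1 + x ≤ exp x`. -/
theorem exists_le_of_le_mul_one_add {G P : ℕ → ℝ} (hG : ∀ n, 0 ≤ G n) (hP : ∀ n, 0 ≤ P n)
    (hsum : Summable P) (h : ∀ n, G (n + 1) ≤ G n * (1 + P n)) : ∃ B, ∀ n, G n ≤ B := by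
  have h1 : ∀ n, G n ≤ G 0 * Real.exp (∑ i ∈ Finset.range n, P i) := by
    intro n
    induction n with
    | zero => simp
    | succ n ih =>
      rw [Finset.sum_range_succ, Real.exp_add, ← mul_assoc]
      refine (h n).trans (mul_le_mul ih ?_ (by have := hP n; positivity) ((hG n).trans ih))
      linarith [Real.add_one_le_exp (P n)]
  refine ⟨G 0 * Real.exp (∑' i, P i), fun n => (h1 n).trans ?_⟩
  exact mul_le_mul_of_nonneg_left
    (Real.exp_le_exp.mpr (hsum.sum_le_tsum _ fun i _ => hP i)) (hG 0)

/-- The pair `(s n, s (n + 1))`, where `e ^ n * s n` is the solution of the recurrence with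
`s 0 = s 1 = 1`. -/
noncomputable def scaledPair (e : ℝ) (P : ℕ → ℝ) : ℕ → ℝ × ℝ
  | 0 => (1, 1)
  | n + 1 =>
    let s := scaledPair e P n
    (s.2, ((1 + e + P n) * s.2 - s.1) / e)

/-- Since `e * (s (n + 2) - s (n + 1)) = (s (n + 1) - s n) + P n * s (n + 1)`, `s` is nondecreasing.
Then `G n = e * s (n + 1) - s n` dominates `(e - 1) * s (n + 1)` and grows by `P n * s (n + 1)`, so
Grönwall bounds `G`, hence `s`. -/
theorem exists_scaled_solution {e : ℝ} (he : 1 < e) {P : ℕ → ℝ} (hP : ∀ n, 0 ≤ P n)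
    (hsum : Summable P) :
    ∃ (s : ℕ → ℝ) (l : ℝ), (∀ n, e * s (n + 2) = (1 + e + P n) * s (n + 1) - s n) ∧
      (∀ n, 1 ≤ s n) ∧ 1 ≤ l ∧ Tendsto s atTop (𝓝 l) := by
  have he0 : 0 < e := by linarith
  set s : ℕ → ℝ := fun n => (scaledPair e P n).1 with hs
  have hrec : ∀ n, e * s (n + 2) = (1 + e + P n) * s (n + 1) - s n := by
    intro n
    simp only [hs, scaledPair]
    field_simp
  have hstep : ∀ n, 1 ≤ s n ∧ s n ≤ s (n + 1) := by
    intro n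
    induction n with
    | zero => simp [hs, scaledPair]
    | succ n ih =>
      refine ⟨ih.1.trans ih.2, ?_⟩
      have h1 := hrec n
      have h2 : 0 ≤ P n * s (n + 1) := mul_nonneg (hP n) (by linarith)
      refine le_of_mul_le_mul_left ?_ he0
      linarith
  have hone : ∀ n, 1 ≤ s n := fun n => (hstep n).1
  have hmono : Monotone s := monotone_nat_of_le_succ fun n => (hstep n).2
  have hG : ∀ n, (e - 1) * s (n + 1) ≤ e * s (n + 1) - s n := fun n => by
    linarith [(hstep n).2]
  have he1 : 0 < e - 1 := by linarith
  obtain ⟨B, hB⟩ := exists_le_of_le_mul_one_add (G := fun n => e * s (n + 1) - s n)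
    (P := fun n => P n / (e - 1))
    (fun n => (mul_nonneg he1.le (by linarith [hone (n + 1)])).trans (hG n))
    (fun n => div_nonneg (hP n) he1.le) (hsum.div_const _) (fun n => by
      have h1 := hrec n
      have h2 : P n * s (n + 1) ≤ (e * s (n + 1) - s n) * (P n / (e - 1)) := by
        calc P n * s (n + 1) = ((e - 1) * s (n + 1)) * (P n / (e - 1)) := by field_simp
          _ ≤ _ := mul_le_mul_of_nonneg_right (hG n) (div_nonneg (hP n) he1.le)
      show e * s (n + 2) - s (n + 1) ≤ _
      linarith)
  have hbdd : BddAbove (Set.range s) := by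
    refine ⟨B / (e - 1), ?_⟩
    rintro _ ⟨n, rfl⟩
    rw [le_div_iff₀ he1, mul_comm]
    exact (mul_le_mul_of_nonneg_left (hstep n).2 he1.le).trans ((hG n).trans (hB n))
  have hlim := tendsto_atTop_ciSup hmono hbdd
  exact ⟨s, _, hrec, hone, ge_of_tendsto' hlim hone, hlim⟩

/-- The second solution, obtained from the first by reduction of order. -/
theorem exists_convergent_solution {e : ℝ} (he : 1 < e) {P s : ℕ → ℝ} {l : ℝ}
    (hrec : ∀ n, e * s (n + 2) = (1 + e + P n) * s (n + 1) - s n) (hone : ∀ n, 1 ≤ s n)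
    (hl : 1 ≤ l) (hlim : Tendsto s atTop (𝓝 l)) :
    ∃ (y : ℕ → ℝ) (m : ℝ), (∀ n, y (n + 2) = (1 + e + P n) * y (n + 1) - e * y n) ∧
      0 < m ∧ Tendsto y atTop (𝓝 m) := by
  have he0 : 0 < e := by linarith
  have hpos : ∀ n, 0 < s n := fun n => by linarith [hone n]
  have hl0 : 0 < l := by linarith
  have hgeom : Summable fun j : ℕ => e⁻¹ ^ j :=
    summable_geometric_of_lt_one (by positivity) (inv_lt_one_of_one_lt₀ he)
  have hle : ∀ n j, e⁻¹ ^ j / (s (n + j) * s (n + j + 1)) ≤ e⁻¹ ^ j := fun n j =>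
    div_le_self (by positivity) (one_le_mul_of_one_le_of_one_le (hone _) (hone _))
  have hnn : ∀ n j, 0 ≤ e⁻¹ ^ j / (s (n + j) * s (n + j + 1)) := fun n j => by
    have := hpos (n + j)
    have := hpos (n + j + 1)
    positivity
  have hS : ∀ n, Summable fun j => e⁻¹ ^ j / (s (n + j) * s (n + j + 1)) := fun n =>
    hgeom.of_nonneg_of_le (hnn n) (hle n)
  -- For the solution `w n = e ^ n * s n`, reduction of order gives `w n * ∑ k ≥ n, e ^ k / (w k * w
  -- (k + 1))`. Setting `k = n + j` and dropping a constant factor `1 / e` leaves `s n * S n`.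
  set S : ℕ → ℝ := fun n => ∑' j, e⁻¹ ^ j / (s (n + j) * s (n + j + 1)) with hSdef
  have hSrec : ∀ n, e * S n = e / (s n * s (n + 1)) + S (n + 1) := by
    intro n
    simp only [hSdef]
    rw [(hS n).tsum_eq_zero_add, mul_add, ← tsum_mul_left]
    congr 1
    · rw [pow_zero, mul_one_div, add_zero]
    · refine tsum_congr fun j => ?_
      rw [show n + (j + 1) = n + 1 + j by omega, pow_succ]
      field_simp
  have hSlim : Tendsto S atTop (𝓝 (∑' j : ℕ, e⁻¹ ^ j / (l * l))) := by
    refine tendsto_tsum_of_dominated_convergence hgeom (fun j => ?_)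
      (Eventually.of_forall fun n j => ?_)
    · exact tendsto_const_nhds.div ((hlim.comp (tendsto_add_atTop_nat j)).mul
        (hlim.comp (tendsto_add_atTop_nat (j + 1)))) (by positivity)
    · rw [Real.norm_of_nonneg (hnn n j)]
      exact hle n j
  refine ⟨fun n => s n * S n, _, fun n => ?_, ?_, hlim.mul hSlim⟩
  · have h0 := hSrec n
    have h1 := hSrec (n + 1)
    have h2 := hrec n
    have p0 := hpos n
    have p1 := hpos (n + 1)
    have p2 := hpos (n + 2)
    have hS1 : S (n + 1) = e * S n - e / (s n * s (n + 1)) := by linarith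
    have hS2 : S (n + 2) = e * S (n + 1) - e / (s (n + 1) * s (n + 2)) := by linarith
    have hd0 : s n * (e / (s n * s (n + 1))) = e / s (n + 1) := by field_simp
    have hd1 : s (n + 2) * (e / (s (n + 1) * s (n + 2))) = e / s (n + 1) := by field_simp
    show s (n + 2) * S (n + 2) = (1 + e + P n) * (s (n + 1) * S (n + 1)) - e * (s n * S n)
    linear_combination s (n + 2) * hS2 + S (n + 1) * h2 - s n * hS1 - hd1 + hd0
  · refine mul_pos hl0 ?_
    rw [tsum_div_const]
    have : 0 < ∑' j : ℕ, e⁻¹ ^ j :=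
      hgeom.tsum_pos (fun j => by positivity) 0 (by simp)
    positivity

theorem solvable_of_lt_neg_one {u v : ℕ → ℝ}
    (h : IsPrincipalSystem expCoeff (fun _ => 0) u v) {γ : ℝ} (hγ : γ < -1) :
    Solvable expCoeff (fun _ => 0) (powExpPerturbation γ) u v := by
  obtain ⟨a, b, ha, hb, hu, hv⟩ := h.exists_const
  have hsum : Summable fun n : ℕ => ((n + 1 : ℕ) : ℝ) ^ γ :=
    (summable_nat_add_iff (f := fun n : ℕ => (n : ℝ) ^ γ) 1).mpr (Real.summable_nat_rpow.mpr hγ)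
  obtain ⟨s, l, hrec, hone, hl, hlim⟩ :=
    exists_scaled_solution one_lt_exp_one (fun n => by positivity) hsum
  obtain ⟨y, m, hy, hm, hylim⟩ := exists_convergent_solution one_lt_exp_one hrec hone hl hlim
  have hl0 : 0 < l := by linarith
  -- The factors make `U` tend to `a` and `expCoeff n * V n` tend to `b`, matching `u` and `v`.
  set U : ℕ → ℝ := fun n => a / m * y n with hUdef
  set V : ℕ → ℝ := fun n => b / l * (Real.exp 1 ^ n * s n) with hVdef
  have hU : Tendsto U atTop (𝓝 a) := by
    have := hylim.const_mul (a / m)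
    rwa [div_mul_cancel₀ _ hm.ne'] at this
  have hrV : ∀ n, expCoeff n * V n = b / l * s n := by
    intro n
    have := Real.exp_pos 1
    rw [expCoeff_eq_inv_pow, hVdef]
    field_simp
  have hV : Tendsto (fun n => expCoeff n * V n) atTop (𝓝 b) := by
    have := hlim.const_mul (b / l)
    rw [div_mul_cancel₀ _ hl0.ne'] at this
    simpa only [hrV] using this
  have hratio : ∀ w : ℕ → ℝ, Tendsto (fun n => expCoeff n * w n) atTop (𝓝 b) →
      Tendsto (fun n => w (n + 1) / w n) atTop (𝓝 (Real.exp 1)) := by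
    intro w hw
    have h1 := ((hw.comp (tendsto_add_atTop_nat 1)).div hw hb.ne').const_mul (Real.exp 1)
    rw [div_self hb.ne', mul_one] at h1
    refine h1.congr fun n => ?_
    have h2 := expCoeff_pos (n + 1)
    have h3 := Real.exp_pos 1
    simp only [Function.comp_apply, Pi.div_apply]
    rw [expCoeff_succ n, ← mul_div_assoc, ← mul_assoc, mul_div_mul_left _ _ (by positivity)]
  have hconst : Tendsto (fun n => 1 / (expCoeff n * u n * v n)) atTop (𝓝 (1 / (a * b))) := by
    refine tendsto_const_nhds.div ((hv.const_mul a).congr fun n => ?_) (by positivity)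
    rw [hu]
    ring
  have hlittleO : ∀ {f : ℕ → ℝ}, Tendsto f atTop (𝓝 0) →
      (fun n => (f n : ℂ)) =o[atTop] fun n => 1 / (expCoeff n * u n * v n) := by
    intro f hf
    have hfc : Tendsto (fun n => (f n : ℂ)) atTop (𝓝 0) := by
      simpa [Function.comp_def] using (Complex.continuous_ofReal.tendsto 0).comp hf
    refine ((isLittleO_one_iff ℝ).mpr hfc).trans_isBigO ?_
    rw [isBigO_const_left_iff_pos_le_norm one_ne_zero]
    have hc : 0 < 1 / (a * b) := by positivity
    refine ⟨1 / (a * b) / 2, half_pos hc, ?_⟩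
    filter_upwards [hconst.eventually (lt_mem_nhds (half_lt_self hc))] with n hn
    exact hn.le.trans (le_abs_self _)
  have hcast : ∀ {f : ℕ → ℝ}, Tendsto f atTop (𝓝 1) →
      Tendsto (fun n => (f n : ℂ)) atTop (𝓝 1) := fun hf => by
    simpa [Function.comp_def] using (Complex.continuous_ofReal.tendsto 1).comp hf
  refine ⟨fun n => (U n : ℂ), fun n => (V n : ℂ), ⟨?_, ?_, ?_⟩, ?_, ?_, ?_, ?_⟩
  · rw [isSolution_powExpPerturbation_iff]
    intro n
    have h1 : U (n + 2) = (1 + Real.exp 1 + ((n + 1 : ℕ) : ℝ) ^ γ) * U (n + 1)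
        - Real.exp 1 * U n := by
      simp only [hUdef, hy n]
      ring
    exact_mod_cast h1
  · rw [isSolution_powExpPerturbation_iff]
    intro n
    have h1 : V (n + 2) = (1 + Real.exp 1 + ((n + 1 : ℕ) : ℝ) ^ γ) * V (n + 1)
        - Real.exp 1 * V n := by
      simp only [hVdef]
      linear_combination b / l * Real.exp 1 ^ (n + 1) * hrec n
    exact_mod_cast h1
  · rw [LinearIndependent.pair_iff]
    intro c d hcd
    have hUc : Tendsto (fun n => (U n : ℂ)) atTop (𝓝 a) :=
      (Complex.continuous_ofReal.tendsto a).comp hU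
    have hVc : Tendsto (fun n => (expCoeff n : ℂ) * (V n : ℂ)) atTop (𝓝 b) := by
      simpa [Function.comp_def] using (Complex.continuous_ofReal.tendsto b).comp hV
    have hrc : Tendsto (fun n => (expCoeff n : ℂ)) atTop (𝓝 0) := by
      simpa [Function.comp_def] using (Complex.continuous_ofReal.tendsto 0).comp tendsto_expCoeff
    have hzero : ∀ n, c * (U n : ℂ) + d * (V n : ℂ) = 0 := fun n => congrFun hcd n
    -- Multiplying the linear relation by `expCoeff n` kills the `U` term in the limit, leaving `d *
    -- b = 0`.
    have hd : d = 0 := by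
      have h1 := ((hrc.mul hUc).const_mul c).add (hVc.const_mul d)
      have h2 : (fun n => c * ((expCoeff n : ℂ) * (U n : ℂ)) +
          d * ((expCoeff n : ℂ) * (V n : ℂ))) = fun _ => 0 := by
        funext n
        linear_combination (expCoeff n : ℂ) * hzero n
      rw [h2] at h1
      have h3 := tendsto_nhds_unique h1 tendsto_const_nhds
      simpa [hb.ne'] using h3
    subst hd
    have h1 := hUc.const_mul c
    have h2 : (fun n => c * (U n : ℂ)) = fun _ => 0 := by
      funext n
      simpa using hzero n
    rw [h2] at h1
    have h3 := tendsto_nhds_unique h1 tendsto_const_nhds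
    exact ⟨by simpa [ha.ne'] using h3, rfl⟩
  · have h1 : Tendsto (fun n => U n / u n) atTop (𝓝 1) := by
      simpa only [hu, div_self ha.ne'] using hU.div_const a
    simpa only [Complex.ofReal_div] using hcast h1
  · have h1 : Tendsto (fun n => V n / v n) atTop (𝓝 1) := by
      have h2 := hV.div hv hb.ne'
      rw [div_self hb.ne'] at h2
      exact h2.congr fun n => mul_div_mul_left _ _ (expCoeff_pos n).ne'
    simpa only [Complex.ofReal_div] using hcast h1
  · have h1 : Tendsto (fun n => U (n + 1) / U n - u (n + 1) / u n) atTop (𝓝 0) := by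
      have h2 := ((hU.comp (tendsto_add_atTop_nat 1)).div hU ha.ne').sub_const 1
      rw [div_self ha.ne', sub_self] at h2
      simpa only [hu, div_self ha.ne', Pi.div_apply, Function.comp_apply] using h2
    simpa only [Complex.ofReal_sub, Complex.ofReal_div] using hlittleO h1
  · have h1 : Tendsto (fun n => V (n + 1) / V n - v (n + 1) / v n) atTop (𝓝 0) := by
      simpa using (hratio V hV).sub (hratio v hv)
    simpa only [Complex.ofReal_sub, Complex.ofReal_div] using hlittleO h1

end Existence

end HartmanWintner

theorem mainTheorem9 :
    (∃ u v : ℕ → ℝ, HartmanWintner.IsPrincipalSystem HartmanWintner.expCoeff (fun _ => 0) u v) ∧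
    ∀ u v : ℕ → ℝ, HartmanWintner.IsPrincipalSystem HartmanWintner.expCoeff (fun _ => 0) u v →
      ∀ γ : ℝ,
        ((0 ≤ γ ∨ γ ∈ Set.Ico (-1 : ℝ) (-1 / 2)) →
          ¬ HartmanWintner.Solvable HartmanWintner.expCoeff (fun _ => 0)
            (HartmanWintner.powExpPerturbation γ) u v) ∧
        (γ < -1 →
          HartmanWintner.Solvable HartmanWintner.expCoeff (fun _ => 0)
            (HartmanWintner.powExpPerturbation γ) u v) := by
  refine ⟨⟨_, _, HartmanWintner.isPrincipalSystem_one_exp⟩, fun u v h γ => ⟨fun hγ => ?_,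
    HartmanWintner.solvable_of_lt_neg_one h⟩⟩
  -- Both ranges of `γ` lie in `[-1, ∞)`, where `∑ n ^ γ` diverges.
  refine HartmanWintner.not_solvable_of_neg_one_le h ?_
  rcases hγ with hγ | hγ
  · linarith
  · exact hγ.1
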